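/- Let $n$ be a natural number and let $\mathbb{H}^n$ be the generalized Heisenberg group, i.e. the group of all real $(n+2)\times(n+2)$ matrices $$\begin{pmatrix} 1 & y & z \\ 0 & I_n & x \\ 0 & 0 & 1 \end{pmatrix},\qquad x,y\in\mathbb{R}^n,\ z\in\mathbb{R},$$ with Lie algebra $\mathfrak{h}^n$, identified both with the tangent space at the identity and with the set of right-invariant vector fields. Consider on $\mathbb{H}^n$ the linear control system $$(\Sigma)\qquad \dot g=\mathcal{X}(g)+\sum_{j=1}^m u_j B_j(g),$$ where $\mathcal{X}$ is a (smooth) linear vector field, that is, a vector field whose flow is a one-parameter group of automorphisms of $\mathbb{H}^n$, and $B_1,\dots,B_m\in\mathfrak{h}^n$ are right-invariant vector fields. The controls $u=(u_1,\dots,u_m)$ are arbitrary functions in $L^\infty([0,T];\mathbb{R}^m)$, and trajectories are absolutely continuous curves that satisfy the equation almost everywhere. Let $D=-\mathrm{ad}(\mathcal{X})$ be the derivation of $\mathfrak{h}^n$ associated with $\mathcal{X}$. Assume that $B_1,\dots,B_m$ are linearly independent and that $(\Sigma)$ satisfies the rank condition: the Lie subalgebra of $\mathfrak{h}^n$ generated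 by $\{D^kY : Y\in\mathrm{Span}(B_1,\dots,B_m),\ k\ge 0\}$ is equal to $\mathfrak{h}^n$. If $m\ge n+1$, then $(\Sigma)$ is controllable in exact time $T$ for every $T>0$: for all $g,g'\in\mathbb{H}^n$ there is a control $u\in L^\infty([0,T];\mathbb{R}^m)$ whose trajectory starting from $g$ at time $0$ is at $g'$ at time $T$. -/

import Mathlib

open Set MeasureTheory
open scoped ENNReal ContDiff

attribute [local instance] LieRing.ofAssociativeRing

noncomputable section

namespace Heisenberg

/-- The Lie algebra `𝔥ⁿ`: the real `(n+2) × (n+2)` matrices whose only nonzero entries are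
strictly above the diagonal and lie in the first row or in the last column, i.e. the matrices
`(0 y z; 0 0 x; 0 0 0)` with `x, y ∈ ℝⁿ` and `z ∈ ℝ`. The bracket is the matrix commutator. -/
def algebra (n : ℕ) : LieSubalgebra ℝ (Matrix (Fin (n + 2)) (Fin (n + 2)) ℝ) where
  carrier := {A | ∀ i j, ¬ (i < j ∧ (i = 0 ∨ j = Fin.last (n + 1))) → A i j = 0}
  zero_mem' := fun _ _ _ => rfl
  add_mem' := fun {A B} hA hB i j h => by
    simp [Matrix.add_apply, hA i j h, hB i j h]
  smul_mem' := fun c A hA i j h => by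
    simp [Matrix.smul_apply, hA i j h]
  lie_mem' := by
    have key : ∀ A B : Matrix (Fin (n + 2)) (Fin (n + 2)) ℝ,
        (∀ i j, ¬ (i < j ∧ (i = 0 ∨ j = Fin.last (n + 1))) → A i j = 0) →
        (∀ i j, ¬ (i < j ∧ (i = 0 ∨ j = Fin.last (n + 1))) → B i j = 0) →
        ∀ i j, ¬ (i < j ∧ (i = 0 ∨ j = Fin.last (n + 1))) → (A * B) i j = 0 := by
      intro A B hA hB i j h
      rw [Matrix.mul_apply]
      refine Finset.sum_eq_zero fun k _ => ?_
      by_cases h1 : i < k ∧ (i = 0 ∨ k = Fin.last (n + 1))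
      · rw [hB k j, mul_zero]
        rintro ⟨h2, -⟩
        rcases h1 with ⟨h1, rfl | rfl⟩
        · exact h ⟨h1.trans h2, Or.inl rfl⟩
        · exact absurd (Fin.le_last j) (not_le.mpr h2)
      · rw [hA i k h1, zero_mul]
    intro A B hA hB i j h
    have h1 := key A B hA hB i j h
    have h2 := key B A hB hA i j h
    simp [Ring.lie_def, h1, h2]

variable {n : ℕ}

theorem mem_algebra {A : Matrix (Fin (n + 2)) (Fin (n + 2)) ℝ} :
    A ∈ algebra n ↔ ∀ i j, ¬ (i < j ∧ (i = 0 ∨ j = Fin.last (n + 1))) → A i j = 0 :=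
  Iff.rfl

theorem mul_mem_algebra {A B : Matrix (Fin (n + 2)) (Fin (n + 2)) ℝ}
    (hA : A ∈ algebra n) (hB : B ∈ algebra n) : A * B ∈ algebra n := by
  intro i j h
  rw [Matrix.mul_apply]
  refine Finset.sum_eq_zero fun k _ => ?_
  by_cases h1 : i < k ∧ (i = 0 ∨ k = Fin.last (n + 1))
  · rw [hB k j, mul_zero]
    rintro ⟨h2, -⟩
    rcases h1 with ⟨h1, rfl | rfl⟩
    · exact h ⟨h1.trans h2, Or.inl rfl⟩
    · exact absurd (Fin.le_last j) (not_le.mpr h2)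
  · rw [hA i k h1, zero_mul]

theorem mul_mul_eq_zero {A B C : Matrix (Fin (n + 2)) (Fin (n + 2)) ℝ}
    (hA : A ∈ algebra n) (hB : B ∈ algebra n) (hC : C ∈ algebra n) : A * B * C = 0 := by
  have hAB : ∀ i j, ¬ (i = 0 ∧ j = Fin.last (n + 1)) → (A * B) i j = 0 := by
    intro i j h
    rw [Matrix.mul_apply]
    refine Finset.sum_eq_zero fun k _ => ?_
    by_cases h1 : i < k ∧ (i = 0 ∨ k = Fin.last (n + 1))
    · by_cases h2 : k < j ∧ (k = 0 ∨ j = Fin.last (n + 1))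
      · exfalso
        have hk0 : k ≠ 0 := fun hk => absurd (hk ▸ h1.1) (by simp)
        have hkl : k ≠ Fin.last (n + 1) :=
          fun hk => absurd (Fin.le_last j) (not_le.mpr (hk ▸ h2.1))
        exact h ⟨h1.2.resolve_right hkl, h2.2.resolve_left hk0⟩
      · rw [hB k j h2, mul_zero]
    · rw [hA i k h1, zero_mul]
  ext i j
  rw [Matrix.mul_apply]
  refine Finset.sum_eq_zero fun k _ => ?_
  by_cases h : i = 0 ∧ k = Fin.last (n + 1)
  · rw [hC k j, mul_zero]
    rintro ⟨h2, -⟩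
    exact absurd (Fin.le_last j) (not_le.mpr (h.2 ▸ h2))
  · rw [hAB i k h, zero_mul]

/-- The generalized Heisenberg group `ℍⁿ`, the subgroup of `GL(n+2, ℝ)` of the matrices
`I + G` with `G ∈ 𝔥ⁿ`, i.e. `(1 y z; 0 I x; 0 0 1)`. -/
def group (n : ℕ) : Subgroup (Matrix.GeneralLinearGroup (Fin (n + 2)) ℝ) where
  carrier := {g | (g : Matrix (Fin (n + 2)) (Fin (n + 2)) ℝ) - 1 ∈ algebra n}
  one_mem' := by simp
  mul_mem' := fun {g h} hg hh => by
    have e : ((g * h : Matrix.GeneralLinearGroup (Fin (n + 2)) ℝ) :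
        Matrix (Fin (n + 2)) (Fin (n + 2)) ℝ) - 1 =
        ((g : Matrix _ _ ℝ) - 1) * ((h : Matrix _ _ ℝ) - 1)
          + ((g : Matrix _ _ ℝ) - 1) + ((h : Matrix _ _ ℝ) - 1) := by
      push_cast
      noncomm_ring
    change _ ∈ algebra n
    rw [e]
    exact add_mem (add_mem (mul_mem_algebra hg hh) hg) hh
  inv_mem' := fun {g} hg => by
    have hg' : (g : Matrix (Fin (n + 2)) (Fin (n + 2)) ℝ) - 1 ∈ algebra n := hg
    generalize hG : (g : Matrix (Fin (n + 2)) (Fin (n + 2)) ℝ) - 1 = G at hg'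
    have hgG : (g : Matrix (Fin (n + 2)) (Fin (n + 2)) ℝ) = 1 + G := by rw [← hG]; abel
    have h3 := mul_mul_eq_zero hg' hg' hg'
    have e : ((g⁻¹ : Matrix.GeneralLinearGroup (Fin (n + 2)) ℝ) :
        Matrix (Fin (n + 2)) (Fin (n + 2)) ℝ) = 1 - G + G * G := by
      apply Units.inv_eq_of_mul_eq_one_right
      rw [hgG]
      calc (1 + G) * (1 - G + G * G) = 1 + G * G * G := by noncomm_ring
        _ = 1 := by rw [h3, add_zero]
    change _ ∈ algebra n
    rw [e]
    have : 1 - G + G * G - 1 = -G + G * G := by abel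
    rw [this]
    exact add_mem (neg_mem hg') (mul_mem_algebra hg' hg')

theorem one_add_mul {A : Matrix (Fin (n + 2)) (Fin (n + 2)) ℝ} (hA : A ∈ algebra n) :
    (1 + A) * (1 - A + A * A) = 1 := by
  calc (1 + A) * (1 - A + A * A) = 1 + A * A * A := by noncomm_ring
    _ = 1 := by rw [mul_mul_eq_zero hA hA hA, add_zero]

theorem mul_one_add {A : Matrix (Fin (n + 2)) (Fin (n + 2)) ℝ} (hA : A ∈ algebra n) :
    (1 - A + A * A) * (1 + A) = 1 := by
  calc (1 - A + A * A) * (1 + A) = 1 + A * A * A := by noncomm_ring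
    _ = 1 := by rw [mul_mul_eq_zero hA hA hA, add_zero]

/-- The matrix of an element of `ℍⁿ`. -/
def mat (g : group n) : Matrix (Fin (n + 2)) (Fin (n + 2)) ℝ :=
  ((g : Matrix.GeneralLinearGroup (Fin (n + 2)) ℝ) : Matrix (Fin (n + 2)) (Fin (n + 2)) ℝ)

/-- The space `ℝⁿ × ℝⁿ × ℝ` of the canonical coordinates `(x, y, z)`. -/
abbrev Coord (n : ℕ) : Type := (Fin n → ℝ) × (Fin n → ℝ) × ℝ

/-- The matrix `(0 y z; 0 0 x; 0 0 0)`. -/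
def toMatrix (p : Coord n) : Matrix (Fin (n + 2)) (Fin (n + 2)) ℝ := fun i j =>
  Fin.lastCases (motive := fun _ => ℝ)
    (Fin.cases p.2.2 (fun i' => Fin.lastCases (motive := fun _ => ℝ) 0 p.1 i') i)
    (fun j' => Fin.cases (Fin.cases 0 p.2.1 j') (fun _ => 0) i) j

theorem toMatrix_zero_last (p : Coord n) : toMatrix p 0 (Fin.last (n + 1)) = p.2.2 := by
  simp only [toMatrix, Fin.lastCases_last, Fin.cases_zero]

theorem toMatrix_castSucc_succ_last (p : Coord n) (i : Fin n) :
    toMatrix p i.castSucc.succ (Fin.last (n + 1)) = p.1 i := by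
  simp only [toMatrix, Fin.lastCases_last, Fin.cases_succ, Fin.lastCases_castSucc]

theorem toMatrix_last_last (p : Coord n) :
    toMatrix p (Fin.last n).succ (Fin.last (n + 1)) = 0 := by
  simp only [toMatrix, Fin.lastCases_last, Fin.cases_succ]

theorem toMatrix_zero_zero (p : Coord n) : toMatrix p 0 (Fin.castSucc 0) = 0 := by
  simp only [toMatrix, Fin.lastCases_castSucc, Fin.cases_zero]

theorem toMatrix_zero_succ_castSucc (p : Coord n) (j : Fin n) :
    toMatrix p 0 j.succ.castSucc = p.2.1 j := by
  simp only [toMatrix, Fin.lastCases_castSucc, Fin.cases_zero, Fin.cases_succ]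

theorem toMatrix_succ_castSucc (p : Coord n) (i j : Fin (n + 1)) :
    toMatrix p i.succ j.castSucc = 0 := by
  simp only [toMatrix, Fin.lastCases_castSucc, Fin.cases_succ]

theorem toMatrix_mem (p : Coord n) : toMatrix p ∈ algebra n := by
  intro i j h
  induction j using Fin.lastCases with
  | last =>
    induction i using Fin.cases with
    | zero => exact absurd ⟨Fin.last_pos, Or.inl rfl⟩ h
    | succ i =>
      induction i using Fin.lastCases with
      | last => exact toMatrix_last_last p
      | cast i => exact absurd ⟨by rw [Fin.succ_castSucc]; exact Fin.castSucc_lt_last _, Or.inr rfl⟩ h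
  | cast j =>
    induction i using Fin.cases with
    | zero =>
      induction j using Fin.cases with
      | zero => exact toMatrix_zero_zero p
      | succ j => exact absurd ⟨by rw [← Fin.succ_castSucc]; exact Fin.succ_pos _, Or.inl rfl⟩ h
    | succ i => exact toMatrix_succ_castSucc p i j

/-- The coordinates `(x, y, z)` of the matrix `(0 y z; 0 0 x; 0 0 0)`. -/
def coords (n : ℕ) : algebra n ≃ₗ[ℝ] Coord n where
  toFun A := (fun i => A.1 i.castSucc.succ (Fin.last (n + 1)),
    fun i => A.1 0 i.succ.castSucc, A.1 0 (Fin.last (n + 1)))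
  map_add' _ _ := rfl
  map_smul' _ _ := rfl
  invFun p := ⟨toMatrix p, toMatrix_mem p⟩
  left_inv A := by
    apply Subtype.ext
    ext i j
    induction j using Fin.lastCases with
    | last =>
      induction i using Fin.cases with
      | zero => exact toMatrix_zero_last _
      | succ i =>
        induction i using Fin.lastCases with
        | last =>
          rw [A.2 _ _ (by simp)]
          exact toMatrix_last_last _
        | cast i => exact toMatrix_castSucc_succ_last _ i
    | cast j =>
      induction i using Fin.cases with
      | zero =>
        induction j using Fin.cases with
        | zero =>
          rw [A.2 _ _ (by simp)]
          exact toMatrix_zero_zero _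
        | succ j => exact toMatrix_zero_succ_castSucc _ j
      | succ i =>
        rw [A.2 _ _ (by simp [(Fin.castSucc_lt_last j).ne, Fin.succ_ne_zero])]
        exact toMatrix_succ_castSucc _ i j
  right_inv p := Prod.ext (funext fun i => toMatrix_castSucc_succ_last p i)
    (Prod.ext (funext fun j => toMatrix_zero_succ_castSucc p j) (toMatrix_zero_last p))

/-- The point `(1 y z; 0 I x; 0 0 1)` of `ℍⁿ` with canonical coordinates `(x, y, z)`. -/
def point (p : Coord n) : group n :=
  ⟨⟨1 + toMatrix p, 1 - toMatrix p + toMatrix p * toMatrix p,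
    one_add_mul (toMatrix_mem p), mul_one_add (toMatrix_mem p)⟩, by
    change 1 + toMatrix p - 1 ∈ algebra n
    rw [add_sub_cancel_left]
    exact toMatrix_mem p⟩

/-- The canonical coordinates `(x, y, z)` of a point `(1 y z; 0 I x; 0 0 1)` of `ℍⁿ`; this global
chart is the inverse of `point`. -/
def chart (g : group n) : Coord n := coords n ⟨mat g - 1, g.2⟩

theorem chart_point (p : Coord n) : chart (point p) = p := by
  have e : (⟨mat (point p) - 1, (point p).2⟩ : algebra n) = (coords n).symm p := by
    apply Subtype.ext
    change 1 + toMatrix p - 1 = toMatrix p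
    rw [add_sub_cancel_left]
  rw [chart, e, LinearEquiv.apply_symm_apply]

theorem point_chart (g : group n) : point (chart g) = g := by
  apply Subtype.ext
  apply Units.ext
  have e : toMatrix (chart g) = mat g - 1 :=
    congrArg Subtype.val ((coords n).symm_apply_apply ⟨mat g - 1, g.2⟩)
  change 1 + toMatrix (chart g) = mat g
  rw [e, add_sub_cancel]

/-- Vector fields on `ℍⁿ`. As `ℍⁿ = I + 𝔥ⁿ` is an affine subspace of the space of matrices, its
tangent space at every point is `𝔥ⁿ`. -/
abbrev VField (n : ℕ) : Type := group n → algebra n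

/-- A vector field read in the canonical coordinates. -/
def VField.inChart (V : VField n) : Coord n → Coord n := fun p => coords n (V (point p))

/-- The Lie bracket `[V, W] = DW · V - DV · W` of two vector fields on `ℍⁿ`, computed in the
canonical coordinates. -/
def bracket (V W : VField n) : VField n := fun g =>
  (coords n).symm (VectorField.lieBracket ℝ V.inChart W.inChart (chart g))

/-- The right-invariant vector field `g ↦ A g` whose value at the identity is `A`. -/
def rightInvariant (A : algebra n) : VField n := fun g =>
  ⟨(A : Matrix (Fin (n + 2)) (Fin (n + 2)) ℝ) * mat g, by
    have e : (A : Matrix (Fin (n + 2)) (Fin (n + 2)) ℝ) * mat g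
        = A * (mat g - 1) + A := by noncomm_ring
    rw [e]
    exact add_mem (mul_mem_algebra A.2 g.2) A.2⟩

/-- A smooth vector field on `ℍⁿ` is linear if it has a (global) flow `φ` which is a one-parameter
group of automorphisms of `ℍⁿ`. -/
def IsLinear (X : VField n) : Prop :=
  ContDiff ℝ ∞ X.inChart ∧
  ∃ φ : ℝ → (group n ≃* group n),
    (∀ g, φ 0 g = g) ∧ (∀ s t g, φ (s + t) g = φ s (φ t g)) ∧
    ∀ g t, HasDerivAt (fun s => chart (φ s g)) (coords n (X (φ t g))) t

/-- The derivation `D = -ad X` associated with a linear vector field `X`. The element `Y` of the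
Lie algebra is identified with the right-invariant vector field whose value at the identity is `Y`,
and the right-invariant field `-[X, Y]` with its value at the identity. -/
def derivation (X : VField n) : algebra n → algebra n := fun Y =>
  -bracket X (rightInvariant Y) 1

/-- `DV = Span {Dᵏ Y ; Y ∈ V, k ∈ ℕ}`, where `V` is the span of `B₁, …, B_m`. -/
def invariantSpan {m : ℕ} (X : VField n) (B : Fin m → algebra n) : Submodule ℝ (algebra n) :=
  Submodule.span ℝ
    {A | ∃ k : ℕ, ∃ Y ∈ Submodule.span ℝ (range B), A = (derivation X)^[k] Y}

/-- The rank condition: the Lie subalgebra generated by `DV` is the whole of `𝔥ⁿ`.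
(The bracket of right-invariant vector fields is the opposite of the matrix commutator; both
brackets generate the same subalgebras.) -/
def RankCondition {m : ℕ} (X : VField n) (B : Fin m → algebra n) : Prop :=
  LieSubalgebra.lieSpan ℝ (algebra n) (invariantSpan X B : Set (algebra n)) = ⊤

/-- `γ` is, on `[0, T]`, the trajectory of the system `ġ = X(g) + ∑ⱼ uⱼ Bⱼ(g)` starting from `g`:
it is absolutely continuous on `[0, T]` and satisfies the equation almost everywhere. -/
def IsTrajectory {m : ℕ} (X : VField n) (B : Fin m → algebra n) (T : ℝ)
    (u : ℝ → Fin m → ℝ) (g : group n) (γ : ℝ → group n) : Prop :=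
  γ 0 = g ∧ AbsolutelyContinuousOnInterval (fun t => chart (γ t)) 0 T ∧
  ∀ᵐ t ∂(volume.restrict (Icc 0 T)),
    HasDerivAt (fun s => chart (γ s))
      (coords n (X (γ t) + ∑ j, u t j • rightInvariant (B j) (γ t))) t

/-- The set `𝒜(g, T)` of the points that can be reached from `g` in time exactly `T`, with
controls in `L^∞([0, T]; ℝᵐ)`. -/
def reachable {m : ℕ} (X : VField n) (B : Fin m → algebra n) (g : group n) (T : ℝ) :
    Set (group n) :=
  {g' | ∃ u : ℝ → Fin m → ℝ, MemLp u ∞ (volume.restrict (Icc 0 T)) ∧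
    ∃ γ : ℝ → group n, IsTrajectory X B T u g γ ∧ γ T = g'}

/-- Controllability in exact time `T`: every point can be steered to every point in time `T`. -/
def ControllableInExactTime {m : ℕ} (X : VField n) (B : Fin m → algebra n) (T : ℝ) : Prop :=
  ∀ g : group n, reachable X B g T = univ

end Heisenberg

end

/-! ### The group law and right-invariant fields in coordinates. -/

namespace Heisenberg

variable {n : ℕ}

/-! In the exponential coordinates `w = (x, y)`, `ζ = z - x·y/2`, a linear vector field becomes
linear: `w ↦ A w`, `ζ ↦ lam ζ + l w` (`IsLinear.exists_normal_form`). A right-invariant field with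
value `(b, β)` at the identity becomes `(b, β + ω(b, w)/2)`, with `ω` the symplectic form. The
system is thus a linear control system on the plane, together with one scalar equation that is
bilinear in `(u, w)`.

Brackets in `𝔥ⁿ` are central, so the rank condition projects to the Kalman condition for `(A, b)`
(`RankCondition.span_planeProj_eq_top`), and `w` can be steered anywhere in any positive time
(`exists_controlState_eq`). It remains to adjust `ζ` without disturbing the end point of `w`.

Since `m > n`, there are two cases. If some nonzero combination of the `B_j` is central, it moves
`ζ` alone (`exists_control_of_central`). Otherwise the `B_j` project to a subspace of dimension
greater than `n`, which is not isotropic, so `ω(b a, b a') ≠ 0` for some `a, a'`. Small loops in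
these two directions close up in `w` and enclose area of either sign (`exists_loop_pos`). Adding `s`
times such a loop to a control changes the final `ζ` by a quadratic polynomial in `s` whose leading
coefficient has the chosen sign, so every value is reached, whatever the linear term
(`exists_control_of_not_symmetric`). -/

theorem mat_eq_one_add (g : group n) : mat g = 1 + toMatrix (chart g) := by
  have e : toMatrix (chart g) = mat g - 1 :=
    congrArg Subtype.val ((coords n).symm_apply_apply ⟨mat g - 1, g.2⟩)
  rw [e, add_sub_cancel]

theorem toMatrix_coords (A : algebra n) : toMatrix (coords n A) = A :=
  congrArg Subtype.val ((coords n).symm_apply_apply A)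

theorem coords_eq_of_coe_eq {A : algebra n} {p : Coord n}
    (h : (A : Matrix (Fin (n + 2)) (Fin (n + 2)) ℝ) = toMatrix p) : coords n A = p := by
  have e : A = (coords n).symm p := Subtype.ext h
  rw [e, LinearEquiv.apply_symm_apply]

theorem toMatrix_add (p q : Coord n) : toMatrix (p + q) = toMatrix p + toMatrix q :=
  congrArg Subtype.val (map_add (coords n).symm p q)

theorem toMatrix_zero_zero' (p : Coord n) : toMatrix p 0 0 = 0 :=
  toMatrix_zero_zero p

theorem toMatrix_last_last' (p : Coord n) :
    toMatrix p (Fin.last (n + 1)) (Fin.last (n + 1)) = 0 :=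
  toMatrix_last_last p

theorem toMatrix_mul (p q : Coord n) :
    toMatrix p * toMatrix q = toMatrix ((0, 0, p.2.1 ⬝ᵥ q.1) : Coord n) := by
  have hmem := mul_mem_algebra (toMatrix_mem p) (toMatrix_mem q)
  change ((⟨_, hmem⟩ : algebra n) : Matrix (Fin (n + 2)) (Fin (n + 2)) ℝ) = _
  rw [← toMatrix_coords ⟨_, hmem⟩]
  congr 1
  refine Prod.ext ?_ (Prod.ext ?_ ?_)
  · funext i
    change (toMatrix p * toMatrix q) i.castSucc.succ (Fin.last (n + 1)) = 0
    rw [Matrix.mul_apply]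
    refine Finset.sum_eq_zero fun k _ => ?_
    induction k using Fin.lastCases with
    | last => rw [toMatrix_last_last', mul_zero]
    | cast k => rw [toMatrix_succ_castSucc, zero_mul]
  · funext i
    change (toMatrix p * toMatrix q) 0 i.succ.castSucc = 0
    rw [Matrix.mul_apply]
    refine Finset.sum_eq_zero fun k _ => ?_
    induction k using Fin.cases with
    | zero => rw [toMatrix_zero_zero', zero_mul]
    | succ k => rw [toMatrix_succ_castSucc, mul_zero]
  · change (toMatrix p * toMatrix q) 0 (Fin.last (n + 1)) = _
    rw [Matrix.mul_apply, Fin.sum_univ_succ, Fin.sum_univ_castSucc]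
    rw [toMatrix_zero_zero', toMatrix_last_last]
    simp only [zero_mul, mul_zero, zero_add, add_zero, dotProduct]
    refine Finset.sum_congr rfl fun i _ => ?_
    rw [toMatrix_castSucc_succ_last, Fin.succ_castSucc]
    exact congrArg (· * _) (toMatrix_zero_succ_castSucc p i)

/-- The group law of `ℍⁿ` in the canonical coordinates. -/
def coordMul (p q : Coord n) : Coord n := (p.1 + q.1, p.2.1 + q.2.1, p.2.2 + q.2.2 + p.2.1 ⬝ᵥ q.1)

theorem coordMul_eq (p q : Coord n) : coordMul p q = p + q + (0, 0, p.2.1 ⬝ᵥ q.1) := by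
  simp [coordMul, Prod.ext_iff]

theorem mat_mul (g h : group n) : mat (g * h) = mat g * mat h := rfl

theorem chart_mul (g h : group n) : chart (g * h) = coordMul (chart g) (chart h) := by
  apply coords_eq_of_coe_eq
  change mat (g * h) - 1 = _
  rw [mat_mul, mat_eq_one_add, mat_eq_one_add, coordMul_eq, toMatrix_add, toMatrix_add,
    ← toMatrix_mul]
  noncomm_ring

theorem point_mul (p q : Coord n) : point p * point q = point (coordMul p q) := by
  rw [← point_chart (point p * point q), chart_mul, chart_point, chart_point]

theorem coords_rightInvariant (A : algebra n) (g : group n) :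
    coords n (rightInvariant A g) =
      coords n A + (0, 0, (coords n A).2.1 ⬝ᵥ (chart g).1) := by
  apply coords_eq_of_coe_eq
  change (A : Matrix (Fin (n + 2)) (Fin (n + 2)) ℝ) * mat g = _
  rw [toMatrix_add, ← toMatrix_mul, toMatrix_coords, mat_eq_one_add, mul_add, mul_one]

theorem chart_one : chart (1 : group n) = 0 := by
  apply coords_eq_of_coe_eq
  change (1 : Matrix (Fin (n + 2)) (Fin (n + 2)) ℝ) - 1 = _
  rw [sub_self]
  exact (congrArg Subtype.val (map_zero (coords n).symm)).symm

end Heisenberg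

theorem HasDerivAt.dotProduct_real {ι : Type*} [Fintype ι] {f g : ℝ → ι → ℝ} {f' g' : ι → ℝ} {t : ℝ}
    (hf : HasDerivAt f f' t) (hg : HasDerivAt g g' t) :
    HasDerivAt (fun s => f s ⬝ᵥ g s) (f' ⬝ᵥ g t + f t ⬝ᵥ g') t := by
  have h : HasDerivAt (fun s => ∑ i, f s i * g s i) (∑ i, (f' i * g t i + f t i * g' i)) t :=
    HasDerivAt.fun_sum fun i _ => (hasDerivAt_pi.1 hf i).mul (hasDerivAt_pi.1 hg i)
  rwa [Finset.sum_add_distrib] at h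

theorem HasDerivAt.prod_fst {E F : Type*} [NormedAddCommGroup E] [NormedSpace ℝ E]
    [NormedAddCommGroup F] [NormedSpace ℝ F] {f : ℝ → E × F} {f' : E × F} {t : ℝ}
    (hf : HasDerivAt f f' t) : HasDerivAt (fun s => (f s).1) f'.1 t :=
  (ContinuousLinearMap.fst ℝ E F).hasFDerivAt.comp_hasDerivAt t hf

theorem HasDerivAt.prod_snd {E F : Type*} [NormedAddCommGroup E] [NormedSpace ℝ E]
    [NormedAddCommGroup F] [NormedSpace ℝ F] {f : ℝ → E × F} {f' : E × F} {t : ℝ}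
    (hf : HasDerivAt f f' t) : HasDerivAt (fun s => (f s).2) f'.2 t :=
  (ContinuousLinearMap.snd ℝ E F).hasFDerivAt.comp_hasDerivAt t hf

/-! ### Linear vector fields in normal form. -/

namespace Heisenberg

variable {n : ℕ}

/-- The space `ℝⁿ × ℝⁿ` of the pairs `(x, y)`. -/
abbrev Plane (n : ℕ) : Type := (Fin n → ℝ) × (Fin n → ℝ)

/-- The coordinates of the exponential of the element `(x, y, 0)` of the Lie algebra. -/
noncomputable def expPoint (w : Plane n) : Coord n := (w.1, w.2, 2⁻¹ * (w.1 ⬝ᵥ w.2))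

/-- Differentiate `φ_s(gh) = φ_s(g) φ_s(h)` at `s = 0`. This infinitesimal form of the automorphism
property is all that the normal form needs besides continuity. -/
theorem IsLinear.inChart_coordMul {X : VField n} (hX : IsLinear X) (p q : Coord n) :
    X.inChart (coordMul p q) =
      ((X.inChart p).1 + (X.inChart q).1, (X.inChart p).2.1 + (X.inChart q).2.1,
        (X.inChart p).2.2 + (X.inChart q).2.2
          + ((X.inChart p).2.1 ⬝ᵥ q.1 + p.2.1 ⬝ᵥ (X.inChart q).1)) := by
  obtain ⟨-, φ, h0, -, hd⟩ := hX
  have key : ∀ p, HasDerivAt (fun s => chart (φ s (point p))) (X.inChart p) 0 := fun p => by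
    have h := hd (point p) 0
    rwa [h0] at h
  have hp := key p
  have hq := key q
  have hpq := key (coordMul p q)
  have e : (fun s => chart (φ s (point (coordMul p q)))) =
      fun s => coordMul (chart (φ s (point p))) (chart (φ s (point q))) := by
    funext s
    rw [← point_mul, map_mul, chart_mul]
  rw [e] at hpq
  refine hpq.unique ?_
  have hp1 := hp.prod_fst
  have hp2 := hp.prod_snd.prod_fst
  have hp3 := hp.prod_snd.prod_snd
  have hq1 := hq.prod_fst
  have hq2 := hq.prod_snd.prod_fst
  have hq3 := hq.prod_snd.prod_snd
  have h := (hp1.add hq1).prodMk ((hp2.add hq2).prodMk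
    ((hp3.add hq3).add (hp2.dotProduct_real hq1)))
  simp only [h0, chart_point] at h
  exact h

/-- The plane components of the field are additive on the group and kill the centre, so they descend
to a continuous additive, hence linear, map `A`. The component along the centre scales central
elements by `lam`; what is left on exponentials is again additive and gives `l`. The last summand is
the derivative of `x·y/2` along `A`, which accounts for the passage from `ζ` to `z`. -/
theorem IsLinear.exists_normal_form {X : VField n} (hX : IsLinear X) :
    ∃ (A : Plane n →L[ℝ] Plane n) (lam : ℝ) (l : Plane n →L[ℝ] ℝ), ∀ p : Coord n,
      X.inChart p = ((A (p.1, p.2.1)).1, (A (p.1, p.2.1)).2,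
        lam * (p.2.2 - 2⁻¹ * (p.1 ⬝ᵥ p.2.1)) + l (p.1, p.2.1)
          + 2⁻¹ * ((A (p.1, p.2.1)).1 ⬝ᵥ p.2.1 + p.1 ⬝ᵥ (A (p.1, p.2.1)).2)) := by
  have hmul := hX.inChart_coordMul
  have hcont : Continuous X.inChart := hX.1.continuous
  set F := X.inChart with hF
  have h1 : ∀ p q, (F (coordMul p q)).1 = (F p).1 + (F q).1 := fun p q => by rw [hmul]
  have h2 : ∀ p q, (F (coordMul p q)).2.1 = (F p).2.1 + (F q).2.1 := fun p q => by rw [hmul]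
  have h3 : ∀ p q, (F (coordMul p q)).2.2 = (F p).2.2 + (F q).2.2
      + ((F p).2.1 ⬝ᵥ q.1 + p.2.1 ⬝ᵥ (F q).1) := fun p q => by rw [hmul]
  -- a homomorphism to an abelian group vanishes on the centre
  have hab : ∀ f : Coord n → (Fin n → ℝ), (∀ p q, f (coordMul p q) = f p + f q) →
      ∀ z, f (0, 0, z) = 0 := by
    intro f hf z
    -- The index `i` supplies `e_i` in both factors; their products in the two orders differ by `(0,
    -- 0, z)`. For `n = 0` there is no component to check.
    funext i
    have e1 : coordMul (Pi.single i 1, 0, 0) (0, Pi.single i z, 0)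
        = (Pi.single i 1, Pi.single i z, 0) := by simp [coordMul]
    have e2 : coordMul (0, Pi.single i z, 0) (Pi.single i 1, 0, 0)
        = (Pi.single i 1, Pi.single i z, z) := by simp [coordMul]
    have e3 : coordMul (Pi.single i 1, Pi.single i z, 0) (0, 0, z)
        = (Pi.single i 1, Pi.single i z, z) := by simp [coordMul]
    have e4 := congrArg f e3
    rw [hf, ← e1, ← e2, hf, hf, add_comm (f (0, _, _))] at e4
    exact congrFun (add_eq_left.mp e4) i
  have hsplit : ∀ p : Coord n, coordMul (p.1, p.2.1, 0) (0, 0, p.2.2) = p := fun p => by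
    simp [coordMul]
  have c1 : ∀ z, (F (0, 0, z)).1 = 0 := hab (fun p => (F p).1) h1
  have c2 : ∀ z, (F (0, 0, z)).2.1 = 0 := hab (fun p => (F p).2.1) h2
  have c3 : ∀ p z, (F (coordMul p (0, 0, z))).2.2 = (F p).2.2 + (F (0, 0, z)).2.2 := by
    intro p z
    rw [h3, c1]
    simp
  -- the induced linear map on the plane
  have a1 : ∀ p : Coord n, (F p).1 = (F (p.1, p.2.1, 0)).1 := fun p => by
    conv_lhs => rw [← hsplit p, h1, c1, add_zero]
  have a2 : ∀ p : Coord n, (F p).2.1 = (F (p.1, p.2.1, 0)).2.1 := fun p => by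
    conv_lhs => rw [← hsplit p, h2, c2, add_zero]
  let A₀ : Plane n → Plane n := fun w => ((F (w.1, w.2, 0)).1, (F (w.1, w.2, 0)).2.1)
  have hA₀ : ∀ w w', A₀ (w + w') = A₀ w + A₀ w' := by
    intro w w'
    refine Prod.ext ?_ ?_
    · change (F (w.1 + w'.1, w.2 + w'.2, 0)).1 = _
      have := h1 (w.1, w.2, 0) (w'.1, w'.2, 0)
      rw [a1] at this
      exact this
    · change (F (w.1 + w'.1, w.2 + w'.2, 0)).2.1 = _
      have := h2 (w.1, w.2, 0) (w'.1, w'.2, 0)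
      rw [a2] at this
      exact this
  have hA₀c : Continuous A₀ := by fun_prop
  let A : Plane n →L[ℝ] Plane n := (AddMonoidHom.mk' A₀ hA₀).toRealLinearMap hA₀c
  have hA1 : ∀ p : Coord n, (F p).1 = (A (p.1, p.2.1)).1 := a1
  have hA2 : ∀ p : Coord n, (F p).2.1 = (A (p.1, p.2.1)).2 := a2
  -- the action on the centre
  have hz : ∀ z z', (F (0, 0, z + z')).2.2 = (F (0, 0, z)).2.2 + (F (0, 0, z')).2.2 := by
    intro z z'
    rw [← c3]
    simp [coordMul]
  let Z : ℝ →L[ℝ] ℝ := (AddMonoidHom.mk' (fun z => (F (0, 0, z)).2.2) hz).toRealLinearMap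
    (by change Continuous fun z => (F (0, 0, z)).2.2; fun_prop)
  have hZ : ∀ z, (F (0, 0, z)).2.2 = Z 1 * z := fun z => by
    have h : Z z = z • Z 1 := by rw [← map_smul, smul_eq_mul, mul_one]
    rw [mul_comm]; exact h
  have hFz : ∀ p : Coord n, (F p).2.2 =
      (F (expPoint (p.1, p.2.1))).2.2 + Z 1 * (p.2.2 - 2⁻¹ * (p.1 ⬝ᵥ p.2.1)) := by
    intro p
    rw [← hZ, ← c3]
    simp [coordMul, expPoint]
  -- The rate of change of `ζ` at the exponential of `(w, 0)`.
  let G : Plane n → ℝ := fun w => (F (expPoint w)).2.2 - 2⁻¹ * ((A w).1 ⬝ᵥ w.2 + w.1 ⬝ᵥ (A w).2)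
  have hG : ∀ w w', G (w + w') = G w + G w' + 2⁻¹ * ((A w).2 ⬝ᵥ w'.1 - (A w).1 ⬝ᵥ w'.2
      + w.2 ⬝ᵥ (A w').1 - w.1 ⬝ᵥ (A w').2) - Z 1 * (2⁻¹ * (w.2 ⬝ᵥ w'.1 - w.1 ⬝ᵥ w'.2)) := by
    intro w w'
    have e := h3 (expPoint w) (expPoint w')
    rw [hFz (coordMul _ _), hA1, hA2] at e
    simp only [G, map_add, expPoint, coordMul] at e ⊢
    simp only [Prod.fst_add, Prod.snd_add, add_dotProduct, dotProduct_add] at e ⊢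
    rw [dotProduct_comm w'.1 w.2, dotProduct_comm w'.1 (A w).2, dotProduct_comm (A w').1 w.2]
    rw [dotProduct_comm w'.1 w.2] at e
    change (F (w.1 + w'.1, w.2 + w'.2, _)).2.2 + _ = _ at e
    have e' : (2⁻¹ : ℝ) * (w.1 ⬝ᵥ w.2 + w.2 ⬝ᵥ w'.1 + (w.1 ⬝ᵥ w'.2 + w'.1 ⬝ᵥ w'.2)) =
      2⁻¹ * (w.1 ⬝ᵥ w.2 + w.1 ⬝ᵥ w'.2 + (w.2 ⬝ᵥ w'.1 + w'.1 ⬝ᵥ w'.2)) := by ring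
    simp only [e'] at e ⊢
    linear_combination e
  -- The defect of additivity in `hG` is antisymmetric in `w, w'`, whereas `G (w + w') - G w - G w'`
  -- is symmetric; so both vanish.
  have hGadd : ∀ w w', G (w + w') = G w + G w' := by
    intro w w'
    have e1 := hG w w'
    have e2 := hG w' w
    rw [add_comm w' w] at e2
    rw [dotProduct_comm w'.2 w.1, dotProduct_comm w'.1 w.2, dotProduct_comm (A w').2 w.1,
      dotProduct_comm (A w').1 w.2, dotProduct_comm w'.2 (A w).1,
      dotProduct_comm w'.1 (A w).2] at e2
    linarith
  have hGc : Continuous G := by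
    have hd : ∀ f g : Plane n → Fin n → ℝ, Continuous f → Continuous g →
        Continuous fun w => f w ⬝ᵥ g w := fun f g hf hg => by
      unfold dotProduct
      fun_prop
    have h4 : Continuous (expPoint : Plane n → Coord n) := by
      have := hd _ _ (continuous_fst (X := Fin n → ℝ) (Y := Fin n → ℝ)) continuous_snd
      unfold expPoint
      fun_prop
    have h5 := hd (fun w => (A w).1) (fun w => w.2) (by fun_prop) (by fun_prop)
    have h6 := hd (fun w => w.1) (fun w => (A w).2) (by fun_prop) (by fun_prop)
    exact ((hcont.comp h4).snd.snd).sub (continuous_const.mul (h5.add h6))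
  let l : Plane n →L[ℝ] ℝ := (AddMonoidHom.mk' G hGadd).toRealLinearMap hGc
  refine ⟨A, Z 1, l, fun p => Prod.ext (hA1 p) (Prod.ext (hA2 p) ?_)⟩
  change (F p).2.2 = Z 1 * (p.2.2 - 2⁻¹ * (p.1 ⬝ᵥ p.2.1)) + G (p.1, p.2.1)
    + 2⁻¹ * ((A (p.1, p.2.1)).1 ⬝ᵥ p.2.1 + p.1 ⬝ᵥ (A (p.1, p.2.1)).2)
  rw [hFz p]
  simp only [G]
  ring

/-! ### From the rank condition to the Kalman condition on the plane. -/

/-- The projection of `𝔥ⁿ` to `ℝⁿ × ℝⁿ` along its centre. -/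
noncomputable def planeProj (n : ℕ) : algebra n →ₗ[ℝ] Plane n :=
  ((LinearMap.fst ℝ _ _).prod ((LinearMap.fst ℝ _ _).comp (LinearMap.snd ℝ _ _))).comp
    (coords n).toLinearMap

theorem planeProj_apply (Y : algebra n) :
    planeProj n Y = ((coords n Y).1, (coords n Y).2.1) := rfl

theorem inChart_rightInvariant (Y : algebra n) (p : Coord n) :
    (rightInvariant Y).inChart p = coords n Y + (0, 0, (coords n Y).2.1 ⬝ᵥ p.1) := by
  rw [VField.inChart, coords_rightInvariant, chart_point]

/-- `X` vanishes at the identity, so only the term with the differential of `X` survives in the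
bracket there: `D` is the differential of `X` at `0`, and it projects to `A`. -/
theorem planeProj_derivation {X : VField n} (hX : IsLinear X) {A : Plane n →L[ℝ] Plane n}
    (hA : ∀ p : Coord n, (X.inChart p).1 = (A (p.1, p.2.1)).1 ∧
      (X.inChart p).2.1 = (A (p.1, p.2.1)).2) (Y : algebra n) :
    planeProj n (derivation X Y) = A (planeProj n Y) := by
  have hX0 : X.inChart 0 = 0 := by
    have h := hX.inChart_coordMul 0 0
    have e : coordMul (0 : Coord n) 0 = 0 := by simp [coordMul]
    rw [e] at h
    have h1 := congrArg Prod.fst h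
    have h2 := congrArg (fun p => p.2.1) h
    have h3 := congrArg (fun p => p.2.2) h
    simp only [left_eq_add] at h1 h2
    simp [h1] at h3
    exact Prod.ext h1 (Prod.ext h2 h3)
  have hd : DifferentiableAt ℝ X.inChart 0 := (hX.1.differentiable (by simp)).differentiableAt
  have e : coords n (derivation X Y) = fderiv ℝ X.inChart 0 (coords n Y) := by
    rw [derivation, bracket, map_neg, LinearEquiv.apply_symm_apply, chart_one,
      VectorField.lieBracket, hX0, map_zero, zero_sub, neg_neg, inChart_rightInvariant]
    have hzero : ((0, 0, (coords n Y).2.1 ⬝ᵥ (0 : Coord n).1) : Coord n) = 0 := by simp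
    rw [hzero, add_zero]
  let P : Coord n →L[ℝ] Plane n := (ContinuousLinearMap.fst ℝ _ _).prod
    ((ContinuousLinearMap.fst ℝ _ _).comp (ContinuousLinearMap.snd ℝ _ _))
  have hPX : ∀ p, P (X.inChart p) = A (P p) := fun p => Prod.ext (hA p).1 (hA p).2
  have h1 : HasFDerivAt (fun p => P (X.inChart p)) (P.comp (fderiv ℝ X.inChart 0)) 0 :=
    P.hasFDerivAt.comp 0 hd.hasFDerivAt
  have h2 : HasFDerivAt (fun p => P (X.inChart p)) (A.comp P) 0 := by
    simp only [hPX]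
    exact (A.comp P).hasFDerivAt
  have h3 := congrArg (fun f : Coord n →L[ℝ] Plane n => f (coords n Y)) (h1.unique h2)
  change P (coords n (derivation X Y)) = _
  rw [e]
  exact h3

/-- Elements of `𝔥ⁿ` whose projection lies in a given subspace form a subalgebra. -/
noncomputable def planeComap (S : Submodule ℝ (Plane n)) : LieSubalgebra ℝ (algebra n) where
  __ := S.comap (planeProj n)
  lie_mem' := by
    intro x y _ _
    have h : planeProj n ⁅x, y⁆ = 0 := by
      have e : coords n ⁅x, y⁆ =
          (0, 0, (coords n x).2.1 ⬝ᵥ (coords n y).1 - (coords n y).2.1 ⬝ᵥ (coords n x).1) := by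
        apply coords_eq_of_coe_eq
        rw [LieSubalgebra.coe_bracket, Ring.lie_def, ← toMatrix_coords x, ← toMatrix_coords y,
          toMatrix_mul, toMatrix_mul, sub_eq_iff_eq_add, ← toMatrix_add]
        simp
      rw [planeProj_apply, e]
      rfl
    change planeProj n ⁅x, y⁆ ∈ S
    rw [h]
    exact S.zero_mem

theorem mem_planeComap {S : Submodule ℝ (Plane n)} {x : algebra n} :
    x ∈ planeComap S ↔ planeProj n x ∈ S := Iff.rfl

/-- The preimage of the Kalman subspace under the projection is a Lie subalgebra, because brackets
project to `0`. It contains all `Dᵏ Y`, hence everything. -/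
theorem RankCondition.span_planeProj_eq_top {m : ℕ} {X : VField n} (hX : IsLinear X)
    {B : Fin m → algebra n} (hrank : RankCondition X B) {A : Plane n →L[ℝ] Plane n}
    (hA : ∀ p : Coord n, (X.inChart p).1 = (A (p.1, p.2.1)).1 ∧
      (X.inChart p).2.1 = (A (p.1, p.2.1)).2) :
    Submodule.span ℝ {w | ∃ (k : ℕ) (j : Fin m), w = A^[k] (planeProj n (B j))} = ⊤ := by
  set S := Submodule.span ℝ {w | ∃ (k : ℕ) (j : Fin m), w = A^[k] (planeProj n (B j))} with hS
  have hAS : S ≤ S.comap A.toLinearMap := by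
    rw [hS, Submodule.span_le]
    rintro _ ⟨k, j, rfl⟩
    refine Submodule.subset_span ⟨k + 1, j, ?_⟩
    rw [Function.iterate_succ_apply']
    rfl
  have hsub : (invariantSpan X B : Set (algebra n)) ⊆ planeComap S := by
    change invariantSpan X B ≤ (planeComap S).toSubmodule
    rw [invariantSpan, Submodule.span_le]
    rintro _ ⟨k, Y, hY, rfl⟩
    change planeProj n _ ∈ S
    induction k with
    | zero =>
      have : Submodule.span ℝ (range B) ≤ S.comap (planeProj n) := by
        rw [Submodule.span_le]
        rintro _ ⟨j, rfl⟩
        exact Submodule.subset_span ⟨0, j, rfl⟩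
      exact this hY
    | succ k ih =>
      rw [Function.iterate_succ_apply', planeProj_derivation hX hA]
      exact hAS ih
  have htop := LieSubalgebra.lieSpan_le.mpr hsub
  rw [hrank] at htop
  rw [eq_top_iff]
  intro w _
  have h := htop (x := (coords n).symm (w.1, w.2, 0)) (LieSubalgebra.mem_top _)
  rw [mem_planeComap, planeProj_apply, LinearEquiv.apply_symm_apply] at h
  exact h

end Heisenberg

/-! ### Steering a driftless system with a quadratic cost. -/

section Steering

variable {E W : Type*} [NormedAddCommGroup E] [NormedSpace ℝ E]
  [NormedAddCommGroup W] [NormedSpace ℝ W]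

/-- The state `t ↦ ∫₀ᵗ C(s) u(s) ds` of the driftless system `ξ' = C(t) u`, as a linear function of
the control `u`. -/
noncomputable def controlState (C : C(ℝ, E →L[ℝ] W)) : C(ℝ, E) →ₗ[ℝ] C(ℝ, W) where
  toFun u :=
    { toFun := fun t => ∫ s in (0 : ℝ)..t, C s (u s)
      continuous_toFun := intervalIntegral.continuous_primitive
        (fun a b => Continuous.intervalIntegrable (by fun_prop) a b) 0 }
  map_add' u v := by
    ext t
    simp only [ContinuousMap.coe_mk, ContinuousMap.add_apply, map_add]
    exact intervalIntegral.integral_add (Continuous.intervalIntegrable (by fun_prop) _ _)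
      (Continuous.intervalIntegrable (by fun_prop) _ _)
  map_smul' c u := by
    ext t
    simp only [ContinuousMap.coe_mk, ContinuousMap.smul_apply, map_smul, RingHom.id_apply]
    exact intervalIntegral.integral_smul _ _

theorem controlState_apply (C : C(ℝ, E →L[ℝ] W)) (u : C(ℝ, E)) (t : ℝ) :
    controlState C u t = ∫ s in (0 : ℝ)..t, C s (u s) := rfl

theorem hasDerivAt_controlState [CompleteSpace W] (C : C(ℝ, E →L[ℝ] W)) (u : C(ℝ, E)) (t : ℝ) :
    HasDerivAt (controlState C u) (C t (u t)) t := by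
  have h : Continuous fun s => C s (u s) := by fun_prop
  exact intervalIntegral.integral_hasDerivAt_right (h.intervalIntegrable _ _)
    (h.stronglyMeasurableAtFilter _ _) h.continuousAt

/-- If a continuous function vanishes before `T - ε`, its integral up to `T` is that of its
rescaling to `[0, 1]`. -/
theorem integral_eq_rescaled {F : Type*} [NormedAddCommGroup F] [NormedSpace ℝ F]
    {g : ℝ → F} (hg : Continuous g) {T ε : ℝ}
    (h0 : ∀ t ≤ T - ε, g t = 0) (hT : ε ≤ T) (σ : ℝ) :
    ∫ t in (0 : ℝ)..(ε * σ + (T - ε)), g t = ε • ∫ τ in (0 : ℝ)..σ, g (ε * τ + (T - ε)) := by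
  rw [intervalIntegral.smul_integral_comp_mul_add, mul_zero, zero_add,
    ← intervalIntegral.integral_add_adjacent_intervals (b := T - ε)
      (hg.intervalIntegrable _ _) (hg.intervalIntegrable _ _)]
  have : ∫ t in (0 : ℝ)..(T - ε), g t = 0 := by
    rw [intervalIntegral.integral_congr (g := fun _ => 0), intervalIntegral.integral_zero]
    intro t ht
    rw [uIcc_of_le (by linarith)] at ht
    exact h0 t ht.2
  rw [this, zero_add]

/-- The profile of a closed loop in the plane of `a` and `a'`. -/
noncomputable def loopProfile (a a' : E) : C(ℝ, E) where
  -- The coefficients are the derivatives of `σ² - σ³` and `σ³ - σ⁴`, which vanish at `0` and at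
  -- `1`; the `max` extends the profile continuously by zero to `σ ≤ 0`.
  toFun σ := (2 * max σ 0 - 3 * max σ 0 ^ 2) • a + (3 * max σ 0 ^ 2 - 4 * max σ 0 ^ 3) • a'

theorem loopProfile_of_nonpos (a a' : E) {σ : ℝ} (h : σ ≤ 0) : loopProfile a a' σ = 0 := by
  simp [loopProfile, max_eq_right h]

theorem loopProfile_of_nonneg (a a' : E) {σ : ℝ} (h : 0 ≤ σ) :
    loopProfile a a' σ = (2 * σ - 3 * σ ^ 2) • a + (3 * σ ^ 2 - 4 * σ ^ 3) • a' := by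
  simp [loopProfile, max_eq_left h]

theorem integral_loopProfile [CompleteSpace W] (K : E →L[ℝ] W) (a a' : E) {σ : ℝ} (h : 0 ≤ σ) :
    ∫ τ in (0 : ℝ)..σ, K (loopProfile a a' τ) =
      (σ ^ 2 - σ ^ 3) • K a + (σ ^ 3 - σ ^ 4) • K a' := by
  have hd : ∀ τ ∈ uIcc 0 σ, HasDerivAt
      (fun τ : ℝ => (τ ^ 2 - τ ^ 3) • K a + (τ ^ 3 - τ ^ 4) • K a')
      (K (loopProfile a a' τ)) τ := by
    intro τ hτ
    rw [uIcc_of_le h] at hτ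
    rw [loopProfile_of_nonneg a a' hτ.1, map_add, map_smul, map_smul]
    have h1 := ((hasDerivAt_pow 2 τ).sub (hasDerivAt_pow 3 τ)).smul_const (K a)
    have h2 := ((hasDerivAt_pow 3 τ).sub (hasDerivAt_pow 4 τ)).smul_const (K a')
    refine (h1.add h2).congr_deriv ?_
    norm_num
  rw [intervalIntegral.integral_eq_sub_of_hasDerivAt hd
    (Continuous.intervalIntegrable (by fun_prop) _ _)]
  simp

/-- With `p = σ² - σ³` and `q = σ³ - σ⁴`, the diagonal terms integrate exact derivatives of `p²/2`
and `q²/2` and drop out, while `∫ q'p = -∫ p'q = 1/210` is the area of the loop `(p, q)`. -/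
theorem integral_bilin_loopProfile [CompleteSpace W] (μ : E →L[ℝ] W →L[ℝ] ℝ) (K : E →L[ℝ] W) (a a' : E) :
    ∫ σ in (0 : ℝ)..1, μ (loopProfile a a' σ) (∫ τ in (0 : ℝ)..σ, K (loopProfile a a' τ)) =
      (μ a' (K a) - μ a (K a')) / 210 := by
  have hcongr : ∫ σ in (0 : ℝ)..1,
      μ (loopProfile a a' σ) (∫ τ in (0 : ℝ)..σ, K (loopProfile a a' τ)) =
      ∫ σ in (0 : ℝ)..1, ((2 * σ - 3 * σ ^ 2) * (σ ^ 2 - σ ^ 3) * μ a (K a)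
        + (2 * σ ^ 4 - 5 * σ ^ 5 + 3 * σ ^ 6) * μ a (K a')
        + (3 * σ ^ 4 - 7 * σ ^ 5 + 4 * σ ^ 6) * μ a' (K a)
        + (3 * σ ^ 2 - 4 * σ ^ 3) * (σ ^ 3 - σ ^ 4) * μ a' (K a')) := by
    refine intervalIntegral.integral_congr fun σ hσ => ?_
    rw [uIcc_of_le zero_le_one] at hσ
    simp only [integral_loopProfile K a a' hσ.1, loopProfile_of_nonneg a a' hσ.1]
    simp only [map_add, map_smul, _root_.add_apply, _root_.smul_apply,
      smul_eq_mul]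
    ring
  have hd : ∀ σ ∈ uIcc (0 : ℝ) 1, HasDerivAt (fun σ : ℝ =>
      (σ ^ 2 - σ ^ 3) ^ 2 * (μ a (K a) / 2)
      + (σ ^ 5 * (2 / 5) - σ ^ 6 * (5 / 6) + σ ^ 7 * (3 / 7)) * μ a (K a')
      + (σ ^ 5 * (3 / 5) - σ ^ 6 * (7 / 6) + σ ^ 7 * (4 / 7)) * μ a' (K a)
      + (σ ^ 3 - σ ^ 4) ^ 2 * (μ a' (K a') / 2))
      ((2 * σ - 3 * σ ^ 2) * (σ ^ 2 - σ ^ 3) * μ a (K a)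
        + (2 * σ ^ 4 - 5 * σ ^ 5 + 3 * σ ^ 6) * μ a (K a')
        + (3 * σ ^ 4 - 7 * σ ^ 5 + 4 * σ ^ 6) * μ a' (K a)
        + (3 * σ ^ 2 - 4 * σ ^ 3) * (σ ^ 3 - σ ^ 4) * μ a' (K a')) σ := by
    intro σ _
    have p := fun k : ℕ => hasDerivAt_pow k σ
    have h1 := ((((p 2).sub (p 3)).pow 2).mul_const (μ a (K a) / 2))
    have h2 := ((((p 5).mul_const (2 / 5)).sub ((p 6).mul_const (5 / 6))).add
      ((p 7).mul_const (3 / 7))).mul_const (μ a (K a'))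
    have h3 := ((((p 5).mul_const (3 / 5)).sub ((p 6).mul_const (7 / 6))).add
      ((p 7).mul_const (4 / 7))).mul_const (μ a' (K a))
    have h4 := ((((p 3).sub (p 4)).pow 2).mul_const (μ a' (K a') / 2))
    refine (((h1.add h2).add h3).add h4).congr_deriv ?_
    simp only [Pi.sub_apply]
    push_cast
    ring
  rw [hcongr, intervalIntegral.integral_eq_sub_of_hasDerivAt hd
    (Continuous.intervalIntegrable (by fun_prop) _ _)]
  ring

/-- The end-point map of the system `ξ' = C(t) u` at time `T`. -/
noncomputable def controlEndpoint (C : C(ℝ, E →L[ℝ] W)) (T : ℝ) : C(ℝ, E) →ₗ[ℝ] W where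
  toFun u := controlState C u T
  map_add' u v := by simp
  map_smul' c u := by simp

/-- A linear map from a finite-dimensional space to a space of continuous functions is jointly
continuous. -/
theorem LinearMap.continuous_eval_of_finiteDimensional {F : Type*} [NormedAddCommGroup F]
    [NormedSpace ℝ F] [FiniteDimensional ℝ W] (f : W →ₗ[ℝ] C(ℝ, F)) : Continuous fun p : W × ℝ => f p.1 p.2 := by
  have h : Continuous f := f.continuous_of_finiteDimensional
  fun_prop

/-- If the end-point map is onto and the area form at the final time is not symmetric, some closed
loop has positive area. -/
theorem exists_loop_pos [FiniteDimensional ℝ W] {C : C(ℝ, E →L[ℝ] W)} {M : C(ℝ, E →L[ℝ] W →L[ℝ] ℝ)} {T : ℝ} (hT : 0 < T)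
    (hsurj : ∀ w, ∃ u, controlState C u T = w) {a a' : E}
    (hM : M T a (C T a') < M T a' (C T a)) :
    ∃ v, controlState C v T = 0 ∧ 0 < ∫ t in (0 : ℝ)..T, M t (v t) (controlState C v t) := by
  have := FiniteDimensional.complete ℝ W
  -- The loop built below closes up only to leading order, since `C` varies in time; `ψ` provides
  -- the correcting control.
  obtain ⟨ψ, hψ⟩ : ∃ ψ : W →ₗ[ℝ] C(ℝ, E), ∀ w, controlState C (ψ w) T = w := by
    obtain ⟨ψ, h⟩ := (controlEndpoint C T).exists_rightInverse_of_surjective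
      (LinearMap.range_eq_top.mpr hsurj)
    exact ⟨ψ, fun w => congrArg (fun f : W →ₗ[ℝ] W => f w) h⟩
  have hψc := ψ.continuous_eval_of_finiteDimensional
  have hSψc := ((controlState C).comp ψ).continuous_eval_of_finiteDimensional
  simp only [LinearMap.comp_apply] at hSψc
  have hψc' : ∀ {Y : Type} [TopologicalSpace Y] {f : Y → W} {g : Y → ℝ}, Continuous f →
      Continuous g → Continuous fun y => ψ (f y) (g y) :=
    fun hf hg => hψc.comp (hf.prodMk hg)
  have hSψc' : ∀ {Y : Type} [TopologicalSpace Y] {f : Y → W} {g : Y → ℝ}, Continuous f →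
      Continuous g → Continuous fun y => controlState C (ψ (f y)) (g y) :=
    fun hf hg => hSψc.comp (hf.prodMk hg)
  set V := loopProfile a a' with hV
  -- The loop is run during `[T - ε, T]`, so that `C` and `M` are nearly frozen at their values at
  -- `T`. Its closing error is `ε • m ε`, with `m 0 = 0`.
  let e : ℝ → ℝ → ℝ := fun ε σ => ε * σ + (T - ε)
  let Ξ : ℝ → ℝ → W := fun ε σ => ∫ τ in (0 : ℝ)..σ, C (e ε τ) (V τ)
  have hec : Continuous fun p : ℝ × ℝ => e p.1 p.2 := by fun_prop
  have hΞc : Continuous fun p : ℝ × ℝ => Ξ p.1 p.2 := by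
    refine intervalIntegral.continuous_parametric_intervalIntegral_of_continuous
      (f := fun (p : ℝ × ℝ) τ => C (e p.1 τ) (V τ)) ?_ continuous_snd
    have : Continuous fun p : (ℝ × ℝ) × ℝ => e p.1.1 p.2 := by fun_prop
    fun_prop
  let m : ℝ → W := fun ε => Ξ ε 1
  have hmc : Continuous m := hΞc.comp (by fun_prop : Continuous fun ε : ℝ => (ε, (1 : ℝ)))
  have hΞ0 : ∀ σ, Ξ 0 σ = ∫ τ in (0 : ℝ)..σ, C T (V τ) := fun σ => by simp [Ξ, e]
  have hm0 : m 0 = 0 := by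
    simp only [m, hΞ0]
    rw [integral_loopProfile _ _ _ zero_le_one]
    simp
  -- The area of the corrected loop is `ε² R(ε)`: one factor `ε` comes from `dt = ε dσ`, the other
  -- from the state or from the correction. As `R` is continuous, the sign of `R 0` decides for
  -- small `ε`.
  let r : ℝ → ℝ → ℝ := fun ε σ => M (e ε σ) (V σ) (Ξ ε σ)
    - M (e ε σ) (V σ) (controlState C (ψ (m ε)) (e ε σ))
    - ε * M (e ε σ) (ψ (m ε) (e ε σ)) (Ξ ε σ)
  let R : ℝ → ℝ := fun ε => (∫ σ in (0 : ℝ)..1, r ε σ)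
    + ∫ t in (0 : ℝ)..T, M t (ψ (m ε) t) (controlState C (ψ (m ε)) t)
  have hRc : Continuous R := by
    have h1 : Continuous fun p : ℝ × ℝ => r p.1 p.2 := by
      have k1 := hψc' (hmc.comp continuous_fst) hec
      have k2 := hSψc' (hmc.comp continuous_fst) hec
      simp only [Function.comp_apply] at k1 k2
      fun_prop
    have h2 : Continuous fun p : ℝ × ℝ => M p.2 (ψ (m p.1) p.2) (controlState C (ψ (m p.1)) p.2) := by
      have k1 := hψc' (hmc.comp continuous_fst) (continuous_snd (X := ℝ) (Y := ℝ))
      have k2 := hSψc' (hmc.comp continuous_fst) (continuous_snd (X := ℝ) (Y := ℝ))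
      simp only [Function.comp_apply] at k1 k2
      fun_prop
    exact (intervalIntegral.continuous_parametric_intervalIntegral_of_continuous' h1 0 1).add
      (intervalIntegral.continuous_parametric_intervalIntegral_of_continuous' h2 0 T)
  have hR0 : 0 < R 0 := by
    have : R 0 = (M T a' (C T a) - M T a (C T a')) / 210 := by
      rw [← integral_bilin_loopProfile]
      simp [R, r, hm0, hΞ0, e, hV]
    rw [this]
    linarith
  obtain ⟨ε, hεT, hε0, hRε⟩ : ∃ ε ≤ T, 0 < ε ∧ 0 < R ε := by
    have h1 : ∀ᶠ ε in nhdsWithin (0 : ℝ) (Ioi 0), 0 < R ε :=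
      (hRc.continuousAt.eventually (lt_mem_nhds hR0)).filter_mono nhdsWithin_le_nhds
    obtain ⟨ε, h, h'⟩ := (h1.and (Ioc_mem_nhdsGT hT)).exists
    exact ⟨ε, h'.2, h'.1, h⟩
  let v : C(ℝ, E) := ⟨fun t => V ((t - (T - ε)) / ε), by fun_prop⟩
  have hv0 : ∀ t ≤ T - ε, v t = 0 := fun t ht =>
    loopProfile_of_nonpos a a' (div_nonpos_of_nonpos_of_nonneg (by linarith) hε0.le)
  have hve : ∀ σ, v (e ε σ) = V σ := fun σ => by
    change V _ = _
    congr 1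
    simp only [e]
    field_simp
    ring
  have hSve : ∀ σ, controlState C v (e ε σ) = ε • Ξ ε σ := fun σ => by
    rw [controlState_apply, integral_eq_rescaled (by fun_prop)
      (fun t ht => by rw [hv0 t ht, map_zero]) hεT]
    simp only [Ξ, ← hve, e]
  have hSv0 : ∀ t ≤ T - ε, controlState C v t = 0 := fun t ht => by
    have ht' : t = e ε ((t - (T - ε)) / ε) := by simp only [e]; field_simp; ring
    have hneg : (t - (T - ε)) / ε ≤ 0 :=
      div_nonpos_of_nonpos_of_nonneg (by linarith) hε0.le
    rw [ht', hSve]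
    simp only [Ξ]
    rw [intervalIntegral.integral_congr (g := fun _ => 0), intervalIntegral.integral_zero,
      smul_zero]
    intro τ hτ
    rw [uIcc_of_ge hneg] at hτ
    simp only [hV, loopProfile_of_nonpos a a' hτ.2, map_zero]
  have heT : e ε 1 = T := by simp only [e]; ring
  refine ⟨v - ε • ψ (m ε), ?_, ?_⟩
  · rw [map_sub, map_smul, ContinuousMap.sub_apply, ContinuousMap.smul_apply, hψ]
    conv_lhs => rw [← heT, hSve]
    exact sub_self _
  · let g : ℝ → ℝ := fun t => M t (v t) (controlState C v t)
      - ε * M t (v t) (controlState C (ψ (m ε)) t) - ε * M t (ψ (m ε) t) (controlState C v t)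
    let f : ℝ → ℝ := fun t => M t (ψ (m ε) t) (controlState C (ψ (m ε)) t)
    have hgc : Continuous g := by fun_prop
    have hfc : Continuous f := by fun_prop
    have h1 : ∀ t, M t ((v - ε • ψ (m ε)) t) (controlState C (v - ε • ψ (m ε)) t)
        = g t + ε ^ 2 * f t := fun t => by
      simp only [g, f, map_sub, map_smul, ContinuousMap.sub_apply, ContinuousMap.smul_apply,
        _root_.sub_apply, _root_.smul_apply, smul_eq_mul]
      ring
    have h2 : ∫ t in (0 : ℝ)..T, g t = ε ^ 2 * ∫ σ in (0 : ℝ)..1, r ε σ := by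
      have h := integral_eq_rescaled (T := T) hgc
        (fun t ht => by simp [g, hv0 t ht, hSv0 t ht]) hεT 1
      change ∫ t in (0 : ℝ)..(e ε 1), g t = _ at h
      rw [heT] at h
      rw [h, pow_two, mul_assoc, ← intervalIntegral.integral_const_mul, smul_eq_mul]
      congr 1
      refine intervalIntegral.integral_congr fun σ _ => ?_
      change g (e ε σ) = _
      simp only [g, r, hve, hSve, map_smul, smul_eq_mul]
      ring
    have h3 : ∫ t in (0 : ℝ)..T, M t ((v - ε • ψ (m ε)) t) (controlState C (v - ε • ψ (m ε)) t)
        = ε ^ 2 * R ε := by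
      simp only [h1]
      rw [intervalIntegral.integral_add (hgc.intervalIntegrable _ _)
        (Continuous.intervalIntegrable (by fun_prop) _ _),
        intervalIntegral.integral_const_mul, h2, ← mul_add]
    rw [h3]
    positivity

/-- The second coordinate at time `T` of the system
`ξ' = C(t) u`, `ζ' = L(t)(w₀ + ξ) + M(t)(u)(w₀ + ξ) + N(t) u` starting from `0`. -/
noncomputable def controlCost (C : C(ℝ, E →L[ℝ] W)) (L : C(ℝ, W →L[ℝ] ℝ))
    (M : C(ℝ, E →L[ℝ] W →L[ℝ] ℝ)) (N : C(ℝ, E →L[ℝ] ℝ)) (w₀ : W) (u : C(ℝ, E)) (T : ℝ) : ℝ :=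
  ∫ t in (0 : ℝ)..T, (L t (w₀ + controlState C u t) + M t (u t) (w₀ + controlState C u t)
    + N t (u t))

/-- The state is linear in the control, so the second-order term in `s` is the area of `v` alone,
independent of `u`. -/
theorem controlCost_add_smul (C : C(ℝ, E →L[ℝ] W)) (L : C(ℝ, W →L[ℝ] ℝ))
    (M : C(ℝ, E →L[ℝ] W →L[ℝ] ℝ)) (N : C(ℝ, E →L[ℝ] ℝ)) (w₀ : W) (u v : C(ℝ, E)) (T s : ℝ) :
    controlCost C L M N w₀ (u + s • v) T = controlCost C L M N w₀ u T
      + s * (∫ t in (0 : ℝ)..T, (L t (controlState C v t) + M t (u t) (controlState C v t)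
        + M t (v t) (w₀ + controlState C u t) + N t (v t)))
      + s ^ 2 * ∫ t in (0 : ℝ)..T, M t (v t) (controlState C v t) := by
  rw [controlCost, controlCost, ← intervalIntegral.integral_const_mul,
    ← intervalIntegral.integral_const_mul, ← intervalIntegral.integral_add,
    ← intervalIntegral.integral_add]
  · refine intervalIntegral.integral_congr fun t _ => ?_
    simp only [map_add, map_smul, ContinuousMap.add_apply, ContinuousMap.smul_apply,
      _root_.add_apply, _root_.smul_apply, smul_eq_mul]
    ring
  all_goals exact Continuous.intervalIntegrable (by fun_prop) _ _

theorem exists_quadratic_eq {c l q k : ℝ} (hq : 0 < q) (hk : c ≤ k) :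
    ∃ s : ℝ, c + s * l + s ^ 2 * q = k := by
  have h : 0 ≤ l ^ 2 + 4 * q * (k - c) := by
    have : 0 ≤ k - c := by linarith
    positivity
  refine ⟨(-l + √(l ^ 2 + 4 * q * (k - c))) / (2 * q), ?_⟩
  field_simp
  linear_combination Real.sq_sqrt h

/-- A driftless system with onto end-point map and an area form which is not symmetric at the final
time is controllable. -/
theorem exists_control_of_not_symmetric [FiniteDimensional ℝ W] {C : C(ℝ, E →L[ℝ] W)} (L : C(ℝ, W →L[ℝ] ℝ))
    {M : C(ℝ, E →L[ℝ] W →L[ℝ] ℝ)} (N : C(ℝ, E →L[ℝ] ℝ)) (w₀ : W) {T : ℝ} (hT : 0 < T)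
    (hsurj : ∀ w, ∃ u, controlState C u T = w) {a a' : E}
    (hM : M T a (C T a') ≠ M T a' (C T a)) (η : W) (κ : ℝ) :
    ∃ u, controlState C u T = η ∧ controlCost C L M N w₀ u T = κ := by
  wlog hlt : M T a (C T a') < M T a' (C T a) generalizing a a'
  · exact this hM.symm (lt_of_le_of_ne (not_lt.mp hlt) hM.symm)
  obtain ⟨u, hu⟩ := hsurj η
  rcases le_total (controlCost C L M N w₀ u T) κ with hκ | hκ
  · obtain ⟨v, hv, hq⟩ := exists_loop_pos hT hsurj hlt
    obtain ⟨s, hs⟩ := exists_quadratic_eq hq hκ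
    exact ⟨u + s • v, by simp [hu, hv], by rw [controlCost_add_smul, hs]⟩
  -- To lower the cost, exchange `a` and `a'` and negate the form: this yields a loop of negative
  -- area.
  · obtain ⟨v, hv, hq⟩ := exists_loop_pos (M := -M) (a := a') (a' := a) hT hsurj
      (by simpa using hlt)
    have hq' : 0 < -∫ t in (0 : ℝ)..T, M t (v t) (controlState C v t) := by
      simpa using hq
    obtain ⟨s, hs⟩ := exists_quadratic_eq hq' (neg_le_neg hκ)
      (l := -∫ t in (0 : ℝ)..T, (L t (controlState C v t) + M t (u t) (controlState C v t)
        + M t (v t) (w₀ + controlState C u t) + N t (v t)))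
    refine ⟨u + s • v, by simp [hu, hv], ?_⟩
    rw [controlCost_add_smul]
    linear_combination -hs

/-- A driftless system with onto end-point map and a constant control which moves the second
coordinate only is controllable. -/
theorem exists_control_of_central {C : C(ℝ, E →L[ℝ] W)} (L : C(ℝ, W →L[ℝ] ℝ))
    {M : C(ℝ, E →L[ℝ] W →L[ℝ] ℝ)} {N : C(ℝ, E →L[ℝ] ℝ)} (w₀ : W) {T : ℝ}
    (hsurj : ∀ w, ∃ u, controlState C u T = w) {a : E} (hC : ∀ t, C t a = 0)
    (hM : ∀ t, M t a = 0) (hN : ∫ t in (0 : ℝ)..T, N t a ≠ 0) (η : W) (κ : ℝ) :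
    ∃ u, controlState C u T = η ∧ controlCost C L M N w₀ u T = κ := by
  obtain ⟨u, hu⟩ := hsurj η
  have hS : ∀ t, controlState C (ContinuousMap.const ℝ a) t = 0 := fun t => by
    simp [controlState_apply, hC]
  -- Along the constant control `a` the state does not move and `M` vanishes, so the cost is affine
  -- in the multiple of `a`, with slope `∫ N t a`.
  refine ⟨u + ((κ - controlCost C L M N w₀ u T) / ∫ t in (0 : ℝ)..T, N t a) •
    ContinuousMap.const ℝ a, by simp [hu, hS], ?_⟩
  rw [controlCost_add_smul]
  simp only [hS, ContinuousMap.const_apply, hM, map_zero, _root_.zero_apply,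
    add_zero, zero_add, intervalIntegral.integral_zero, mul_zero]
  rw [div_mul_cancel₀ _ hN]
  ring

end Steering

/-! ### Removing the linear drift. -/

section Drift

variable {E W : Type*} [NormedAddCommGroup E] [NormedSpace ℝ E]
  [NormedAddCommGroup W] [NormedSpace ℝ W]

/-- The flow `t ↦ exp(tA)` of a linear vector field. -/
noncomputable def linearFlow (A : W →L[ℝ] W) (t : ℝ) : W →L[ℝ] W := NormedSpace.exp (t • A)

theorem linearFlow_zero (A : W →L[ℝ] W) : linearFlow A 0 = 1 := by
  simp [linearFlow]

variable [CompleteSpace W]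

theorem hasDerivAt_linearFlow (A : W →L[ℝ] W) (t : ℝ) :
    HasDerivAt (linearFlow A) (A * linearFlow A t) t :=
  hasDerivAt_exp_smul_const' A t

theorem hasDerivAt_linearFlow' (A : W →L[ℝ] W) (t : ℝ) :
    HasDerivAt (linearFlow A) (linearFlow A t * A) t :=
  hasDerivAt_exp_smul_const A t

theorem continuous_linearFlow (A : W →L[ℝ] W) : Continuous (linearFlow A) :=
  continuous_iff_continuousAt.mpr fun t => (hasDerivAt_linearFlow A t).continuousAt

theorem linearFlow_mul_neg (A : W →L[ℝ] W) (t : ℝ) :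
    linearFlow A t * linearFlow A (-t) = 1 := by
  rw [linearFlow, linearFlow, neg_smul]
  let := NormedAlgebra.restrictScalars ℚ ℝ (W →L[ℝ] W)
  rw [← NormedSpace.exp_add_of_commute ((Commute.refl _).neg_right), add_neg_cancel,
    NormedSpace.exp_zero]

theorem linearFlow_apply_neg (A : W →L[ℝ] W) (t : ℝ) (w : W) :
    linearFlow A t (linearFlow A (-t) w) = w :=
  congrArg (fun f : W →L[ℝ] W => f w) (linearFlow_mul_neg A t)

/-- The drift `A` removed from the control operator `b`. -/
noncomputable def pulledControl (A : W →L[ℝ] W) (b : E →L[ℝ] W) : C(ℝ, E →L[ℝ] W) where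
  toFun t := (linearFlow A (-t)).comp b
  continuous_toFun := by
    have := continuous_linearFlow A
    fun_prop

theorem pulledControl_apply (A : W →L[ℝ] W) (b : E →L[ℝ] W) (t : ℝ) (a : E) :
    pulledControl A b t a = linearFlow A (-t) (b a) := rfl

/-- The Kalman condition makes the end-point map onto. -/
theorem exists_controlState_eq [FiniteDimensional ℝ W] {A : W →L[ℝ] W} {b : E →L[ℝ] W}
    (hspan : Submodule.span ℝ {w | ∃ (k : ℕ) (a : E), w = A^[k] (b a)} = ⊤) {T : ℝ} (hT : 0 < T)
    (w : W) : ∃ u, controlState (pulledControl A b) u T = w := by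
  suffices h : LinearMap.range (controlEndpoint (pulledControl A b) T) = ⊤ from
    LinearMap.range_eq_top.mp h w
  by_contra hne
  obtain ⟨f, hf0, hf⟩ := Submodule.exists_le_ker_of_lt_top _ (lt_top_iff_ne_top.mpr hne)
  let η : W →L[ℝ] ℝ := f.toContinuousLinearMap
  have hη : ∀ u, η (controlState (pulledControl A b) u T) = 0 := fun u => hf ⟨u, rfl⟩
  have h0 : ∀ a : E, ∀ t ∈ Ioo 0 T, η (linearFlow A (-t) (b a)) = 0 := by
    intro a
    have hc : Continuous fun t => η (pulledControl A b t a) := by fun_prop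
    -- Feeding back `η` itself as the control makes the annihilated integral that of a square.
    have h := hη ⟨fun t => η (pulledControl A b t a) • a, by fun_prop⟩
    rw [controlState_apply, ← ContinuousLinearMap.intervalIntegral_comp_comm _
      (Continuous.intervalIntegrable (by fun_prop) _ _)] at h
    simp only [ContinuousMap.coe_mk, map_smul, smul_eq_mul] at h
    intro t ht
    by_contra hne
    have hpos : 0 < ∫ t in (0 : ℝ)..T, η (pulledControl A b t a) * η (pulledControl A b t a) :=
      intervalIntegral.integral_pos hT (hc.mul hc).continuousOn
        (fun s _ => mul_self_nonneg _) ⟨t, Ioo_subset_Icc_self ht, mul_self_pos.mpr hne⟩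
    exact hpos.ne' h
  -- Each differentiation in `t` on the open interval brings down one more factor `A`. At a single
  -- time, `η` composed with an invertible flow then kills the Kalman span, so `η = 0`.
  have hk : ∀ (k : ℕ) (a : E), ∀ t ∈ Ioo 0 T, η (linearFlow A (-t) (A^[k] (b a))) = 0 := by
    intro k a
    induction k with
    | zero => exact h0 a
    | succ k ih =>
      intro t ht
      have h1 : HasDerivAt (fun s => η (linearFlow A (-s) (A^[k] (b a))))
          (-η (linearFlow A (-t) (A (A^[k] (b a))))) t := by
        have h2 : HasDerivAt (fun s => linearFlow A (-s)) (-(linearFlow A (-t) * A)) t := by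
          refine ((hasDerivAt_linearFlow' A (-t)).scomp t (hasDerivAt_neg t)).congr_deriv ?_
          rw [neg_one_smul]
        have h3 := h2.clm_apply (hasDerivAt_const t (A^[k] (b a)))
        refine (η.hasFDerivAt.comp_hasDerivAt t h3).congr_deriv ?_
        simp
      have h2 : HasDerivAt (fun s => η (linearFlow A (-s) (A^[k] (b a)))) 0 t :=
        (hasDerivAt_const t (0 : ℝ)).congr_of_eventuallyEq
          (Filter.eventually_of_mem (isOpen_Ioo.mem_nhds ht) ih)
      rw [Function.iterate_succ_apply']
      simpa using h1.unique h2
  have hmid : T / 2 ∈ Ioo 0 T := ⟨by linarith, by linarith⟩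
  have hle : Submodule.span ℝ {w | ∃ (k : ℕ) (a : E), w = A^[k] (b a)} ≤
      LinearMap.ker (η.comp (linearFlow A (-(T / 2)))).toLinearMap := by
    rw [Submodule.span_le]
    rintro _ ⟨k, a, rfl⟩
    exact hk k a _ hmid
  rw [hspan, top_le_iff] at hle
  refine hf0 (LinearMap.ext fun w => ?_)
  have h : linearFlow A (T / 2) w ∈
      LinearMap.ker (η.comp (linearFlow A (-(T / 2)))).toLinearMap := hle ▸ Submodule.mem_top
  have h1 : η (linearFlow A (-(T / 2)) (linearFlow A (T / 2) w)) = 0 := h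
  have h2 := linearFlow_apply_neg A (-(T / 2)) w
  rw [neg_neg] at h2
  rw [h2] at h1
  exact h1

/-- Steering for the system `w' = A w + b u`, `z' = λ z + l w + μ(u, w) + β u`. -/
theorem exists_steering_trajectory [FiniteDimensional ℝ W] {A : W →L[ℝ] W} {b : E →L[ℝ] W}
    (hspan : Submodule.span ℝ {w | ∃ (k : ℕ) (a : E), w = A^[k] (b a)} = ⊤) (lam : ℝ)
    (l : W →L[ℝ] ℝ) {μ : E →L[ℝ] W →L[ℝ] ℝ} {β : E →L[ℝ] ℝ}
    (hμ : (∃ a a', μ a (b a') ≠ μ a' (b a)) ∨ ∃ a, b a = 0 ∧ μ a = 0 ∧ β a ≠ 0)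
    {T : ℝ} (hT : 0 < T) (w₀ w₁ : W) (z₀ z₁ : ℝ) :
    ∃ (u : C(ℝ, E)) (w : ℝ → W) (z : ℝ → ℝ), w 0 = w₀ ∧ z 0 = z₀ ∧ w T = w₁ ∧ z T = z₁ ∧
      (∀ t, HasDerivAt w (A (w t) + b (u t)) t) ∧
      ∀ t, HasDerivAt z (lam * z t + l (w t) + μ (u t) (w t) + β (u t)) t := by
  have hΦ := continuous_linearFlow A
  -- Variation of constants: `w = exp(tA)(w₀ + ξ)` and `z = exp(lam t)(z₀ + ζ)` turn the system into
  -- a driftless one for `ξ`, with cost `ζ`.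
  let C := pulledControl A b
  let L : C(ℝ, W →L[ℝ] ℝ) :=
    ⟨fun t => Real.exp (-(lam * t)) • l.comp (linearFlow A t), by fun_prop⟩
  let M : C(ℝ, E →L[ℝ] W →L[ℝ] ℝ) :=
    ⟨fun t => Real.exp (-(lam * t)) •
      ((ContinuousLinearMap.compL ℝ W W ℝ).flip (linearFlow A t)).comp μ, by fun_prop⟩
  let N : C(ℝ, E →L[ℝ] ℝ) := ⟨fun t => Real.exp (-(lam * t)) • β, by fun_prop⟩
  have hM : ∀ t a w, M t a w = Real.exp (-(lam * t)) * μ a (linearFlow A t w) :=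
    fun _ _ _ => rfl
  have hsurj := exists_controlState_eq hspan hT
  obtain ⟨u, hu1, hu2⟩ : ∃ u, controlState C u T = linearFlow A (-T) w₁ - w₀ ∧
      controlCost C L M N w₀ u T = Real.exp (-(lam * T)) * z₁ - z₀ := by
    rcases hμ with ⟨a, a', h⟩ | ⟨a, hb, hμa, hβ⟩
    · refine exists_control_of_not_symmetric L N w₀ hT hsurj (a := a) (a' := a') ?_ _ _
      -- The flow in `M` cancels the inverse flow in `C`, leaving `μ a (b a')` times a nonzero
      -- exponential.
      simp only [hM, pulledControl_apply, linearFlow_apply_neg]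
      exact fun h' => h (mul_left_cancel₀ (Real.exp_ne_zero _) h')
    · refine exists_control_of_central L w₀ hsurj (a := a) (fun t => ?_) (fun t => ?_) ?_ _ _
      · rw [pulledControl_apply, hb, map_zero]
      · ext w
        rw [hM, hμa]
        simp
      · change ∫ t in (0 : ℝ)..T, Real.exp (-(lam * t)) * β a ≠ 0
        rw [intervalIntegral.integral_mul_const]
        refine mul_ne_zero (ne_of_gt ?_) hβ
        exact intervalIntegral.intervalIntegral_pos_of_pos
          (Continuous.intervalIntegrable (by fun_prop) _ _) (fun t => Real.exp_pos _) hT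
  refine ⟨u, fun t => linearFlow A t (w₀ + controlState C u t),
    fun t => Real.exp (lam * t) * (z₀ + controlCost C L M N w₀ u t), ?_, ?_, ?_, ?_, ?_, ?_⟩
  · simp [linearFlow_zero, controlState_apply]
  · simp [controlCost]
  · simp only [hu1, add_sub_cancel, linearFlow_apply_neg]
  · simp only [hu2, add_sub_cancel]
    rw [← mul_assoc, ← Real.exp_add]
    simp
  · intro t
    have h := (hasDerivAt_linearFlow A t).clm_apply
      ((hasDerivAt_controlState C u t).const_add w₀)
    simp only [C, pulledControl_apply, linearFlow_apply_neg] at h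
    exact h
  · intro t
    have hcost : HasDerivAt (controlCost C L M N w₀ u)
        (L t (w₀ + controlState C u t) + M t (u t) (w₀ + controlState C u t) + N t (u t)) t := by
      have hc : Continuous fun t => L t (w₀ + controlState C u t)
          + M t (u t) (w₀ + controlState C u t) + N t (u t) := by fun_prop
      exact intervalIntegral.integral_hasDerivAt_right (hc.intervalIntegrable _ _)
        (hc.stronglyMeasurableAtFilter _ _) hc.continuousAt
    have hexp : HasDerivAt (fun t => Real.exp (lam * t)) (Real.exp (lam * t) * lam) t := by
      simpa using ((hasDerivAt_id t).const_mul lam).exp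
    refine (hexp.mul (hcost.const_add z₀)).congr_deriv ?_
    have hinv : Real.exp (lam * t) * Real.exp (-(lam * t)) = 1 := by
      rw [← Real.exp_add]; simp
    rw [hM]
    change _ + Real.exp (lam * t) * (Real.exp (-(lam * t)) * l _ + _
      + Real.exp (-(lam * t)) * β (u t)) = _
    linear_combination (l (linearFlow A t (w₀ + controlState C u t))
      + μ (u t) (linearFlow A t (w₀ + controlState C u t)) + β (u t)) * hinv

end Drift

/-! ### The symplectic form and the dimension count. -/

namespace Heisenberg

variable {n m : ℕ}

/-- The symplectic form on `ℝⁿ × ℝⁿ` induced by the bracket. -/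
noncomputable def symplecticForm (n : ℕ) : LinearMap.BilinForm ℝ (Plane n) :=
  LinearMap.mk₂ ℝ (fun w w' => w.2 ⬝ᵥ w'.1 - w.1 ⬝ᵥ w'.2)
    (fun _ _ _ => by simp [add_dotProduct]; ring)
    (fun _ _ _ => by simp; ring)
    (fun _ _ _ => by simp [dotProduct_add]; ring)
    (fun _ _ _ => by simp; ring)

theorem symplecticForm_apply (w w' : Plane n) :
    symplecticForm n w w' = w.2 ⬝ᵥ w'.1 - w.1 ⬝ᵥ w'.2 := rfl

theorem symplecticForm_swap (w w' : Plane n) :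
    symplecticForm n w w' = -symplecticForm n w' w := by
  rw [symplecticForm_apply, symplecticForm_apply, dotProduct_comm w.1, dotProduct_comm w.2]
  ring

theorem ker_symplecticForm : LinearMap.ker (symplecticForm n) = ⊥ := by
  rw [LinearMap.ker_eq_bot']
  intro w h
  refine Prod.ext (funext fun i => ?_) (funext fun i => ?_)
  · have := congrArg (fun f => f ((0, Pi.single i 1) : Plane n)) h
    simpa [symplecticForm_apply] using this
  · have := congrArg (fun f => f ((Pi.single i 1, 0) : Plane n)) h
    simpa [symplecticForm_apply] using this

/-- A subspace of dimension larger than `n` is not isotropic. -/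
theorem exists_symplecticForm_ne_zero {S : Submodule ℝ (Plane n)}
    (hS : n < Module.finrank ℝ S) : ∃ w ∈ S, ∃ w' ∈ S, symplecticForm n w w' ≠ 0 := by
  by_contra! h
  -- Nondegeneracy gives `dim S + dim S^⊥ = 2n`, so an isotropic `S` has dimension at most `n`.
  have hle : S ≤ (symplecticForm n).orthogonal S := fun w' hw' w hw => h w hw w' hw'
  have h1 := Submodule.finrank_mono hle
  have h2 := LinearMap.BilinForm.finrank_add_finrank_orthogonal' (B := symplecticForm n) S
  rw [ker_symplecticForm, inf_bot_eq, finrank_bot, add_zero] at h2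
  have h3 : Module.finrank ℝ (Plane n) = n + n := by simp
  omega

theorem sum_smul_rightInvariant (B : Fin m → algebra n) (a : Fin m → ℝ) (g : group n) :
    ∑ j, a j • rightInvariant (B j) g = rightInvariant (∑ j, a j • B j) g := by
  apply Subtype.ext
  simp only [rightInvariant, AddSubmonoidClass.coe_finsetSum, SetLike.val_smul]
  rw [Finset.sum_mul]
  simp

end Heisenberg

/-! ### The controllability theorem. -/

theorem corollary1 (n m : ℕ) (X : Heisenberg.VField n) (hX : Heisenberg.IsLinear X)
    (B : Fin m → Heisenberg.algebra n) (hB : LinearIndependent ℝ B)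
    (hrank : Heisenberg.RankCondition X B) (hm : n + 1 ≤ m) :
    ∀ T : ℝ, 0 < T → Heisenberg.ControllableInExactTime X B T := by
  open Heisenberg in
  intro T hT g
  rw [eq_univ_iff_forall]
  intro g'
  obtain ⟨A, lam, l, hF⟩ := hX.exists_normal_form
  have hA : ∀ p : Coord n, (X.inChart p).1 = (A (p.1, p.2.1)).1 ∧
      (X.inChart p).2.1 = (A (p.1, p.2.1)).2 := fun p => by rw [hF]; exact ⟨rfl, rfl⟩
  let S : (Fin m → ℝ) →ₗ[ℝ] algebra n := Fintype.linearCombination ℝ B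
  have hS : ∀ a, S a = ∑ j, a j • B j := fun _ => rfl
  let b : (Fin m → ℝ) →L[ℝ] Plane n := ((planeProj n).comp S).toContinuousLinearMap
  have hb : ∀ a, b a = ((coords n (S a)).1, (coords n (S a)).2.1) := fun _ => rfl
  let β : (Fin m → ℝ) →L[ℝ] ℝ := ((LinearMap.snd ℝ _ _).comp ((LinearMap.snd ℝ _ _).comp
    ((coords n).toLinearMap.comp S))).toContinuousLinearMap
  have hβ : ∀ a, β a = (coords n (S a)).2.2 := fun _ => rfl
  -- The factor `1/2` appears because `b₂·x` in the right-invariant field loses `(b₁·y + x·b₂)/2` in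
  -- passing from `z` to `ζ`.
  let μ : (Fin m → ℝ) →L[ℝ] Plane n →L[ℝ] ℝ :=
    ((2⁻¹ : ℝ) • (symplecticForm n).toContinuousBilinearMap).comp b
  have hμ : ∀ a w, μ a w = 2⁻¹ * symplecticForm n (b a) w := fun _ _ => rfl
  have hspan : Submodule.span ℝ {w | ∃ (k : ℕ) (a : Fin m → ℝ), w = A^[k] (b a)} = ⊤ := by
    rw [eq_top_iff, ← hrank.span_planeProj_eq_top hX hA]
    refine Submodule.span_mono ?_
    rintro _ ⟨k, j, rfl⟩
    refine ⟨k, Pi.single j 1, ?_⟩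
    change _ = A^[k] (planeProj n (Fintype.linearCombination ℝ B (Pi.single j 1)))
    rw [Fintype.linearCombination_apply_single, one_smul]
  have halt : (∃ a a', μ a (b a') ≠ μ a' (b a)) ∨ ∃ a, b a = 0 ∧ μ a = 0 ∧ β a ≠ 0 := by
    -- If the projection is injective on controls, its image has dimension `m > n`. Otherwise a
    -- nonzero control has a central value, which is nonzero by linear independence.
    by_cases hinj : LinearMap.ker ((planeProj n).comp S) = ⊥
    · left
      have hfin : n < Module.finrank ℝ (LinearMap.range ((planeProj n).comp S)) := by
        rw [LinearMap.finrank_range_of_inj (LinearMap.ker_eq_bot.mp hinj)]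
        simpa using hm
      obtain ⟨_, ⟨a, rfl⟩, _, ⟨a', rfl⟩, h⟩ := exists_symplecticForm_ne_zero hfin
      refine ⟨a, a', ?_⟩
      rw [hμ, hμ, symplecticForm_swap (b a')]
      change symplecticForm n (b a) (b a') ≠ 0 at h
      intro h'
      exact h (by linarith)
    · right
      obtain ⟨a, ha, ha0⟩ := Submodule.exists_mem_ne_zero_of_ne_bot hinj
      have hba : b a = 0 := ha
      refine ⟨a, hba, ?_, fun h => ha0 ?_⟩
      · refine ContinuousLinearMap.ext fun w => ?_
        rw [hμ, hba]
        simp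
      · have hSa : S a = 0 := by
          rw [← (coords n).map_eq_zero_iff]
          have h1 := congrArg Prod.fst ((hb a).symm.trans hba)
          have h2 := congrArg Prod.snd ((hb a).symm.trans hba)
          exact Prod.ext h1 (Prod.ext h2 h)
        exact funext fun j => Fintype.linearIndependent_iff.mp hB a hSa j
  let W : Coord n → Plane n := fun p => (p.1, p.2.1)
  -- The exponential coordinate `ζ`; `c` below converts back to canonical coordinates.
  let Z : Coord n → ℝ := fun p => p.2.2 - 2⁻¹ * (p.1 ⬝ᵥ p.2.1)
  obtain ⟨u, w, z, hw0, hz0, hwT, hzT, hw, hz⟩ := exists_steering_trajectory hspan lam l halt hT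
    (W (chart g)) (W (chart g')) (Z (chart g)) (Z (chart g'))
  let c : ℝ → Coord n := fun t => ((w t).1, (w t).2, z t + 2⁻¹ * ((w t).1 ⬝ᵥ (w t).2))
  have hcc : ∀ t p, w t = W p → z t = Z p → c t = p := by
    intro t p h1 h2
    simp [c, h1, h2, W, Z]
  have hc : ∀ t, HasDerivAt c (coords n (X (point (c t)) +
      ∑ j, u t j • rightInvariant (B j) (point (c t)))) t := by
    intro t
    have h1 := (hw t).prod_fst
    have h2 := (hw t).prod_snd
    refine (h1.prodMk (h2.prodMk ((hz t).add ((h1.dotProduct_real h2).const_mul 2⁻¹)))).congr_deriv ?_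
    rw [sum_smul_rightInvariant, ← hS, map_add, coords_rightInvariant, chart_point]
    change _ = X.inChart (c t) + _
    rw [hF]
    refine Prod.ext ?_ (Prod.ext ?_ ?_)
    · simp [c, hb]
    · simp [c, hb]
    · simp [c, hb, hμ, hβ, symplecticForm_apply, add_dotProduct, dotProduct_add]
      rw [dotProduct_comm (w t).1 (coords n (S (u t))).2.1]
      ring
  -- The control found is continuous, so the trajectory is `C¹`, which yields absolute continuity.
  have hcC1 : ContDiff ℝ 1 c := by
    rw [contDiff_one_iff_deriv]
    refine ⟨fun t => (hc t).differentiableAt, ?_⟩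
    have hcont : Continuous c := continuous_iff_continuousAt.mpr fun t => (hc t).continuousAt
    have e : deriv c = fun t => X.inChart (c t) +
        ∑ j, u t j • (coords n (B j) + (0, 0, (coords n (B j)).2.1 ⬝ᵥ (c t).1)) := by
      funext t
      rw [(hc t).deriv, map_add, map_sum]
      simp only [map_smul, coords_rightInvariant, chart_point]
      rfl
    rw [e]
    have hXc := hX.1.continuous
    have hd : ∀ v : Fin n → ℝ, Continuous fun t => v ⬝ᵥ (c t).1 := fun v => by
      unfold dotProduct
      fun_prop
    fun_prop
  refine ⟨u, ?_, fun t => point (c t), ⟨?_, ?_, ?_⟩, ?_⟩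
  · obtain ⟨K, hK⟩ := isCompact_Icc.exists_bound_of_continuousOn
      (s := Icc 0 T) u.continuous.continuousOn
    exact memLp_top_of_bound u.continuous.aestronglyMeasurable K
      ((ae_restrict_mem measurableSet_Icc).mono hK)
  · change point (c 0) = g
    rw [hcc 0 _ hw0 hz0, point_chart]
  · simp only [chart_point]
    exact hcC1.contDiffOn.absolutelyContinuousOnInterval
  · simp only [chart_point]
    exact Filter.Eventually.of_forall hc
  · change point (c T) = g'
    rw [hcc T _ hwT hzT, point_chart]
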